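/- Consider circuits on two qubits (top and bottom line, no ancillas) over the gate library consisting of the rotations $R_y(\theta)=\begin{pmatrix}\cos\frac\theta2&\sin\frac\theta2\\-\sin\frac\theta2&\cos\frac\theta2\end{pmatrix}$ and $R_z(\theta)=\mathrm{diag}(e^{-i\theta/2},e^{i\theta/2})$, $0\le\theta<2\pi$, on either line, and the two CNOT gates $\mathtt{topCNOT}$ (control top, exchanging $|10\rangle\leftrightarrow|11\rangle$) and $\mathtt{botCNOT}$ (control bottom, exchanging $|01\rangle\leftrightarrow|11\rangle$). A circuit implements $U\in U(4)$ if the operator it computes equals $U$ up to a global phase. Let $$E=\frac{\sqrt2}{2}\begin{pmatrix}1&i&0&0\\0&0&i&1\\0&0&i&-1\\1&-i&0&0\end{pmatrix}$$ in the basis $|00\rangle,|01\rangle,|10\rangle,|11\rangle$ (the entangler). Write $H=R_z(\pi)R_y(\pi/2)$, $S=R_z(\pi/2)$ and $S'=R_z(3\pi/2)$; up to phase these are the Hadamard gate, $\mathrm{diag}(1,i)$ and $\mathrm{diag}(1,-i)$. In what follows gates are listed in the order in which they act. The following two circuits of seven gates (4 CNOTs and 3 constant rotations each) implement $E$ and $E^*$,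 respectively: $\mathtt{botCNOT}$, $S$ on top, $\mathtt{botCNOT}$, $H$ on bottom, $\mathtt{topCNOT}$, $\mathtt{botCNOT}$; and $\mathtt{botCNOT}$, $\mathtt{topCNOT}$, $H$ on bottom, $\mathtt{botCNOT}$, $S'$ on top, $\mathtt{botCNOT}$. Let $C(\theta_0,\dots,\theta_{14})$ be the following fixed circuit with 15 parameters, independent of the unitary to be implemented: 1. first layer: $R_z(\theta_0),R_y(\theta_1),R_z(\theta_2)$ on top and $R_z(\theta_3),R_y(\theta_4),R_z(\theta_5)$ on bottom; 2. core: the above circuit for $E^*$; then $R_z(\theta_6)$ on top, $R_z(\theta_7)$ on bottom, $\mathtt{botCNOT}$, $R_z(\theta_8)$ on top; then $\mathtt{botCNOT}$, $H$ on bottom, $\mathtt{topCNOT}$, $\mathtt{botCNOT}$; 3. last layer: $R_z(\theta_9),R_y(\theta_{10}),R_z(\theta_{11})$ on top and $R_z(\theta_{12}),R_y(\theta_{13}),R_z(\theta_{14})$ on bottom. It has exactly 28 gates (some of which may be trivial for particular parameter values): 15 variable rotations (each parameter occurs in exactly one of them), 5 constant rotations and 8 CNOTs. Every two-qubit unitary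 can be implemented by this circuit, hence by at most 28 elementary gates. More precisely, for every $U\in U(4)$ there are $U_1,U_2,U_3,U_4\in U(2)$ and a diagonal unitary $D\in U(4)$ with $$U=(U_1\otimes U_2)\,(E D E^*)\,(U_3\otimes U_4),$$ and parameters $\theta_0,\dots,\theta_{14}\in[0,2\pi)$ such that the first layer implements $U_3\otimes U_4$, the core implements $EDE^*$, the last layer implements $U_1\otimes U_2$, and $C(\theta_0,\dots,\theta_{14})$ implements $U$; moreover, for some $\gamma\in[0,2\pi)$ the five-gate circuit $R_z(\theta_6)$ on top, $R_z(\theta_7)$ on bottom, $\mathtt{botCNOT}$, $R_z(\gamma)$ on top, $\mathtt{botCNOT}$ implements $D$. -/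

import Mathlib

open scoped Kronecker

namespace TwoQubit

noncomputable section

/-- `4 × 4` operators on two qubits. Rows and columns are indexed by the computational basis
`|ab⟩`, with `a` the top (first) qubit and `b` the bottom (second) qubit. -/
abbrev Op : Type := Matrix (Fin 2 × Fin 2) (Fin 2 × Fin 2) ℂ

/-- A `4 × 4` matrix written in the lexicographically ordered basis
`|00⟩, |01⟩, |10⟩, |11⟩`. -/
def ofLex (M : Matrix (Fin 4) (Fin 4) ℂ) : Op :=
  M.submatrix finProdFinEquiv finProdFinEquiv

/-- The two lines of the circuit. -/
inductive Line
  | top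
  | bot

/-- A one-qubit operator acting on the given line. -/
def Line.act : Line → Matrix (Fin 2) (Fin 2) ℂ → Op
  | .top, A => A ⊗ₖ (1 : Matrix (Fin 2) (Fin 2) ℂ)
  | .bot, A => (1 : Matrix (Fin 2) (Fin 2) ℂ) ⊗ₖ A

/-- The axis of an elementary rotation. -/
inductive Axis
  | y
  | z

/-- The parameter range `[0, 2π)` of an elementary rotation. -/
abbrev Angle : Type := Set.Ico (0 : ℝ) (2 * Real.pi)

/-- The elementary rotations `R_y(θ)` and `R_z(θ)`. -/
def Axis.rotation : Axis → ℝ → Matrix (Fin 2) (Fin 2) ℂ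
  | .y, θ => !![(Real.cos (θ / 2) : ℂ), (Real.sin (θ / 2) : ℂ);
                -(Real.sin (θ / 2) : ℂ), (Real.cos (θ / 2) : ℂ)]
  | .z, θ => !![Complex.exp (-(Complex.I * (θ / 2 : ℝ))), 0;
                0, Complex.exp (Complex.I * (θ / 2 : ℝ))]

/-- The CNOT gate controlled by the given line. -/
def cnotMatrix : Line → Op
  | .top => ofLex !![1, 0, 0, 0; 0, 1, 0, 0; 0, 0, 0, 1; 0, 0, 1, 0]
  | .bot => ofLex !![1, 0, 0, 0; 0, 0, 0, 1; 0, 0, 1, 0; 0, 1, 0, 0]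

/-- The library of elementary gates: rotations about `y` and `z` on either line, and CNOTs
controlled by either line. -/
inductive Gate
  | rot (a : Axis) (l : Line) (θ : Angle)
  | cnot (control : Line)

/-- The unitary computed by an elementary gate. -/
def Gate.matrix : Gate → Op
  | .rot a l θ => l.act (a.rotation θ)
  | .cnot c => cnotMatrix c

/-- The operator computed by a circuit, that is, a list of gates in the order of application
(the first gate of the list acts first, so it is the rightmost factor of the product). -/
def eval : List Gate → Op
  | [] => 1
  | g :: gs => eval gs * g.matrix

/-- The circuit computes `U` up to global phase. -/
def Implements (C : List Gate) (U : Op) : Prop :=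
  ∃ c : ℂ, ‖c‖ = 1 ∧ eval C = c • U

/-- One place of a parametrized circuit with `n` real parameters: a CNOT, a constant rotation
(of fixed angle), or a variable rotation whose angle is the parameter number `j`. -/
inductive Slot (n : ℕ)
  | cnot (control : Line)
  | const (a : Axis) (l : Line) (θ : Angle)
  | var (a : Axis) (l : Line) (j : Fin n)

namespace Slot

variable {n : ℕ}

/-- The gate obtained when the parameters are given values. -/
def toGate (θ : Fin n → Angle) : Slot n → Gate
  | .cnot c => .cnot c
  | .const a l t => .rot a l t
  | .var a l j => .rot a l (θ j)

/-- Is this a CNOT? -/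
def isCnot : Slot n → Bool
  | .cnot _ => true
  | _ => false

/-- Is this a constant rotation? -/
def isConstant : Slot n → Bool
  | .const _ _ _ => true
  | _ => false

/-- Is this a variable rotation? -/
def isVariable : Slot n → Bool
  | .var _ _ _ => true
  | _ => false

/-- Is this a variable rotation by the parameter number `j`? -/
def usesParam (j : Fin n) : Slot n → Bool
  | .var _ _ i => i == j
  | _ => false

end Slot

/-- The circuit obtained from a parametrized circuit by giving values to its parameters. -/
def instantiate {n : ℕ} (T : List (Slot n)) (θ : Fin n → Angle) : List Gate :=
  T.map (Slot.toGate θ)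

/-- The angle `π / 2`. -/
def halfPi : Angle := ⟨Real.pi / 2, by have := Real.pi_pos; constructor <;> linarith⟩

/-- The angle `π`. -/
def onePi : Angle := ⟨Real.pi, by have := Real.pi_pos; constructor <;> linarith⟩

/-- The angle `3π / 2`. -/
def threeHalfPi : Angle := ⟨3 * Real.pi / 2, by have := Real.pi_pos; constructor <;> linarith⟩

/-- The Hadamard gate on the given line, as two constant rotations:
`H = R_z(π) R_y(π/2)` up to phase. -/
def hadamard {n : ℕ} (l : Line) : List (Slot n) :=
  [.const .y l halfPi, .const .z l onePi]

/-- A generic one-qubit gate on the given line, as three variable rotations. -/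
def oneQubit {n : ℕ} (l : Line) (i j k : Fin n) : List (Slot n) :=
  [.var .z l i, .var .y l j, .var .z l k]

/-- The entangler, whose columns are the vectors of the magic basis. -/
def E : Op :=
  ((Real.sqrt 2 / 2 : ℝ) : ℂ) •
    ofLex !![1, Complex.I, 0, 0;
             0, 0, Complex.I, 1;
             0, 0, Complex.I, -1;
             1, -Complex.I, 0, 0]

/-- The circuit of seven gates for the entangler `E`. The rotation `R_z(π/2)` is
`S = diag(1, i)` up to phase. -/
def entangler {n : ℕ} : List (Slot n) :=
  [.cnot .bot, .const .z .top halfPi, .cnot .bot] ++ hadamard .bot ++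
    [.cnot .top, .cnot .bot]

/-- The circuit of seven gates for the disentangler `E*`: the inverses of the parts of the
entangler circuit in reverse order. The rotation `R_z(3π/2)` is `S* = diag(1, -i)` up to phase,
and the Hadamard gate is its own inverse. -/
def disentangler {n : ℕ} : List (Slot n) :=
  [.cnot .bot, .cnot .top] ++ hadamard .bot ++
    [.cnot .bot, .const .z .top threeHalfPi, .cnot .bot]

/-- The circuit of five gates for diagonal unitaries, with the CNOTs on the output side. -/
def diagonalCircuit (α β γ : Angle) : List Gate :=
  [.rot .z .top α, .rot .z .bot β, .cnot .bot, .rot .z .top γ, .cnot .bot]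

/-- The circuit for `E D E*`, with `D` diagonal: the disentangler, then the diagonal circuit,
then the entangler, where the last CNOT of the diagonal circuit has been cancelled against the
first CNOT of the entangler, and the constant rotation of the entangler which follows it has been
merged into the last variable rotation of the diagonal circuit. -/
def core {n : ℕ} (i j k : Fin n) : List (Slot n) :=
  disentangler ++
    [.var .z .top i, .var .z .bot j, .cnot .bot, .var .z .top k] ++
    [.cnot .bot] ++ hadamard .bot ++ [.cnot .top, .cnot .bot]

/-- The gates which act before the core. -/
def firstLayer : List (Slot 15) := oneQubit .top 0 1 2 ++ oneQubit .bot 3 4 5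

/-- The gates which act after the core. -/
def lastLayer : List (Slot 15) := oneQubit .top 9 10 11 ++ oneQubit .bot 12 13 14

/-- The whole parametrized circuit. -/
def circuit28 : List (Slot 15) := firstLayer ++ core 6 7 8 ++ lastLayer

end

end TwoQubit

namespace TwoQubit

noncomputable section

open Matrix

/-! The columns of `E` form the magic basis, in which local operators of determinant one become
real: conjugation by `E` carries SO(4) into U(2) ⊗ U(2). Hence a factorization O₁ D O₂ of E* U E,
with O₁, O₂ special orthogonal and D diagonal, gives the decomposition of U.

Such a factorization exists for every unitary V. The matrix W = V Vᵀ is symmetric and unitary, so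
its real and imaginary parts are commuting real symmetric matrices, and one orthogonal matrix
diagonalizes both: W = O₁ D² O₁ᵀ. Then O₂ = D⁻¹ O₁ᵀ V satisfies both O₂ O₂* = 1 and O₂ O₂ᵀ = 1, so
it is real (`exists_orthogonal_mul_diagonal_mul_orthogonal`); signs are moved into D to make both
determinants one. That SO(4) becomes local is checked on generators: Givens rotations of
neighbouring coordinates generate SO(4) (`specialOrthogonalGroup_induction`), and each becomes a
tensor product of two elementary rotations (`exists_E_mul_givens_mul_star_E`).

On the circuit side, Euler angles give the local factors, three parity phases give D, and explicit
products give E and E*. Concatenating the circuits for E*, D and E brings two equal CNOTs together;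
they cancel, and the two rotations about z that thereby meet merge into one (`implements_core`). -/

variable {n : ℕ}

/-! ### Unitary matrices as products orthogonal · diagonal · orthogonal -/

/-- Two commuting real symmetric matrices are diagonalized by a common orthogonal matrix. -/
theorem exists_orthogonal_mul_diagonal {X Y : Matrix (Fin n) (Fin n) ℝ} (hX : X.IsSymm)
    (hY : Y.IsSymm) (hXY : X * Y = Y * X) :
    ∃ O ∈ orthogonalGroup (Fin n) ℝ, ∃ x y : Fin n → ℝ,
      X * O = O * diagonal x ∧ Y * O = O * diagonal y := by
  classical
  set A := toEuclideanLin X with hA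
  set B := toEuclideanLin Y with hB
  have hAs : A.IsSymmetric := isSymmetric_toEuclideanLin_iff.mpr (by
    rw [IsHermitian, conjTranspose_eq_transpose_of_trivial, hX])
  have hBs : B.IsSymmetric := isSymmetric_toEuclideanLin_iff.mpr (by
    rw [IsHermitian, conjTranspose_eq_transpose_of_trivial, hY])
  have hAB : Commute A B := by
    refine LinearMap.ext fun v => ?_
    ext i
    simp [hA, hB, toEuclideanLin, hXY]
  have hfam := LinearMap.IsSymmetric.orthogonalFamily_eigenspace_inf_eigenspace hAs hBs
  -- The joint eigenspaces are indexed by all of ℝ × ℝ; only the finitely many nonzero ones are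
  -- kept, since the adapted orthonormal basis needs a finite index type.
  have hint := DirectSum.isInternal_ne_bot_iff.mpr
    (LinearMap.IsSymmetric.directSum_isInternal_of_commute hAs hBs hAB)
  have hfin := Submodule.finite_ne_bot_of_iSupIndep
    (LinearMap.IsSymmetric.directSum_isInternal_of_commute hAs hBs hAB).submodule_iSupIndep
  have : Fintype {i : ℝ × ℝ // Module.End.eigenspace A i.2 ⊓ Module.End.eigenspace B i.1 ≠ ⊥} :=
    hfin.fintype
  have hfam' := hfam.comp (Subtype.val_injective (p := fun i : ℝ × ℝ =>
    Module.End.eigenspace A i.2 ⊓ Module.End.eigenspace B i.1 ≠ ⊥))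
  have hn : Module.finrank ℝ (EuclideanSpace ℝ (Fin n)) = n := by simp
  obtain ⟨b, hb⟩ : ∃ b : OrthonormalBasis (Fin n) ℝ (EuclideanSpace ℝ (Fin n)),
      ∀ j, ∃ x y : ℝ, A (b j) = x • b j ∧ B (b j) = y • b j :=
    ⟨hint.subordinateOrthonormalBasis hn hfam', fun j => by
      have := hint.subordinateOrthonormalBasis_subordinate hn j hfam'
      exact ⟨_, _, Module.End.mem_eigenspace_iff.mp this.1,
        Module.End.mem_eigenspace_iff.mp this.2⟩⟩
  choose x y hx hy using hb
  refine ⟨of fun i j => b j i, ?_, x, y, ?_, ?_⟩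
  · rw [mem_orthogonalGroup_iff']
    ext i j
    have := orthonormal_iff_ite.mp b.orthonormal i j
    rw [PiLp.inner_apply] at this
    rw [one_apply, ← this, mul_apply]
    exact Finset.sum_congr rfl fun k _ => by simp [mul_comm]
  · ext i j
    have := congrArg (fun v : EuclideanSpace ℝ (Fin n) => v i) (hx j)
    rw [mul_diagonal, mul_apply, of_apply, mul_comm]
    simpa [hA, toEuclideanLin, mulVec, dotProduct] using this
  · ext i j
    have := congrArg (fun v : EuclideanSpace ℝ (Fin n) => v i) (hy j)
    rw [mul_diagonal, mul_apply, of_apply, mul_comm]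
    simpa [hB, toEuclideanLin, mulVec, dotProduct] using this

/-- An orthogonal matrix becomes special orthogonal after a change of signs of its columns. -/
theorem exists_sign_mul_mem_specialOrthogonalGroup [NeZero n] {O : Matrix (Fin n) (Fin n) ℝ}
    (hO : O ∈ orthogonalGroup (Fin n) ℝ) :
    ∃ s : Fin n → ℝ, (∀ i, s i * s i = 1) ∧
      O * diagonal s ∈ specialOrthogonalGroup (Fin n) ℝ := by
  have hdet : O.det * O.det = 1 := by
    have := congrArg det ((mem_orthogonalGroup_iff (Fin n) ℝ).mp hO)
    simpa [star_eq_conjTranspose] using this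
  -- Only column 0 is rescaled, by det O = ±1, so the new determinant is (det O)² = 1.
  have hs : ∀ i, Function.update (1 : Fin n → ℝ) 0 O.det i *
      Function.update (1 : Fin n → ℝ) 0 O.det i = 1 := fun i => by
    by_cases h : i = 0
    · subst h; simpa using hdet
    · simp [h]
  refine ⟨Function.update 1 0 O.det, hs, ?_⟩
  rw [mem_specialOrthogonalGroup_iff]
  refine ⟨mul_mem hO ?_, ?_⟩
  · rw [mem_orthogonalGroup_iff, diagonal_transpose, diagonal_mul_diagonal, ← diagonal_one]
    congr 1
    funext i
    simpa using hs i
  · rw [det_mul, det_diagonal, Finset.prod_update_of_mem (Finset.mem_univ _)]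
    simpa using hdet

/-- A complex square root of a number of modulus one. -/
theorem exists_sq_eq_of_norm_eq_one {z : ℂ} (hz : ‖z‖ = 1) : ∃ w : ℂ, ‖w‖ = 1 ∧ w * w = z := by
  obtain ⟨w, hw⟩ := IsAlgClosed.exists_pow_nat_eq z (n := 2) two_pos
  refine ⟨w, ?_, by rw [← sq, hw]⟩
  have : ‖w‖ ^ 2 = 1 := by rw [← norm_pow, hw, hz]
  exact (pow_eq_one_iff_of_nonneg (norm_nonneg w) two_ne_zero).mp this

theorem mul_star_self_of_norm_eq_one {z : ℂ} (hz : ‖z‖ = 1) : z * star z = 1 := by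
  rw [Complex.star_def, Complex.mul_conj, Complex.normSq_eq_norm_sq, hz]; simp

/-- A unitary matrix is a product `O₁ D O₂` of orthogonal, diagonal and orthogonal factors. -/
theorem exists_orthogonal_mul_diagonal_mul_orthogonal {V : Matrix (Fin n) (Fin n) ℂ}
    (hV : V ∈ unitaryGroup (Fin n) ℂ) :
    ∃ O₁ ∈ orthogonalGroup (Fin n) ℝ, ∃ O₂ ∈ orthogonalGroup (Fin n) ℝ, ∃ d : Fin n → ℂ,
      (∀ i, ‖d i‖ = 1) ∧
        V = O₁.map Complex.ofReal * diagonal d * O₂.map Complex.ofReal := by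
  have hV1 : V * Vᴴ = 1 := (mem_unitaryGroup_iff).mp hV
  -- If V = O₁ D O₂, then V Vᵀ = O₁ D² O₁ᵀ no longer involves O₂: diagonalizing W recovers O₁ and
  -- D².
  set W := V * Vᵀ with hW
  have hWs : Wᵀ = W := by simp [hW]
  have hVt : Vᵀ * Vᵀᴴ = 1 := by
    have := congrArg transpose ((mem_unitaryGroup_iff').mp hV)
    simpa [star_eq_conjTranspose, transpose_mul, conjTranspose, transpose_map] using this
  have hWW : W * Wᴴ = 1 := by
    rw [hW, conjTranspose_mul, Matrix.mul_assoc, ← Matrix.mul_assoc Vᵀ, hVt, Matrix.one_mul, hV1]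
  set X := W.map Complex.re with hXd
  set Y := W.map Complex.im with hYd
  have hX : Xᵀ = X := by rw [hXd, ← transpose_map, hWs]
  have hY : Yᵀ = Y := by rw [hYd, ← transpose_map, hWs]
  have hdecomp : W = X.map Complex.ofReal + Complex.I • Y.map Complex.ofReal := by
    ext i j
    simp [hXd, hYd, mul_comm Complex.I]
  have hcomm : X * Y = Y * X := by
    -- This is the imaginary part of (X + iY)(X + iY)* = 1.
    have h : Y * Xᵀ - X * Yᵀ = 0 := by
      ext i j
      have := congrArg Complex.im (congrFun (congrFun hWW i) j)
      have h0 : ((1 : Matrix (Fin n) (Fin n) ℂ) i j).im = 0 := by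
        by_cases h : i = j <;> simp [one_apply, h]
      rw [h0, mul_apply, Complex.im_sum] at this
      refine Eq.trans ?_ this
      simp only [Matrix.sub_apply, mul_apply, ← Finset.sum_sub_distrib]
      refine Finset.sum_congr rfl fun k _ => ?_
      simp [hXd, hYd]
      ring
    rw [hX, hY] at h
    exact (sub_eq_zero.mp h).symm
  obtain ⟨O, hO, x, y, hx, hy⟩ := exists_orthogonal_mul_diagonal (X := X) (Y := Y) hX hY hcomm
  have hOO : Oᵀ * O = 1 := by
    simpa [star_eq_conjTranspose] using (mem_orthogonalGroup_iff' (Fin n) ℝ).mp hO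
  have map_mul' : ∀ M N : Matrix (Fin n) (Fin n) ℝ, (M * N).map Complex.ofReal =
      M.map Complex.ofReal * N.map Complex.ofReal := fun M N => by
    exact Matrix.map_mul (f := Complex.ofRealHom)
  have map_one' : (1 : Matrix (Fin n) (Fin n) ℝ).map Complex.ofReal = 1 :=
    Matrix.map_one _ Complex.ofReal_zero Complex.ofReal_one
  set P := O.map Complex.ofReal with hP
  have hPP : Pᵀ * P = 1 := by rw [hP, ← transpose_map, ← map_mul', hOO, map_one']
  have hPP' : P * Pᵀ = 1 := mul_eq_one_comm.mp hPP
  have hPstar : Pᴴ = Pᵀ := by ext i j; simp [hP]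
  set e2 : Fin n → ℂ := fun i => x i + Complex.I * y i with he2
  have hWP : W * P = P * diagonal e2 := by
    have h1 := congrArg (fun M : Matrix (Fin n) (Fin n) ℝ => M.map Complex.ofReal) hx
    have h2 := congrArg (fun M : Matrix (Fin n) (Fin n) ℝ => M.map Complex.ofReal) hy
    simp only [map_mul'] at h1 h2
    rw [hdecomp, Matrix.add_mul, Matrix.smul_mul, ← hP] at *
    rw [h1, h2]
    ext i j
    simp [mul_diagonal, he2, diagonal_map]
    ring
  have hPWP : Pᵀ * W * P = diagonal e2 := by
    rw [Matrix.mul_assoc, hWP, ← Matrix.mul_assoc, hPP, Matrix.one_mul]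
  have he2n : ∀ i, ‖e2 i‖ = 1 := fun i => by
    have h : diagonal e2 * (diagonal e2)ᴴ = 1 := by
      rw [← hPWP]
      simp only [conjTranspose_mul, hPstar]
      have : (Pᵀ)ᴴ = P := by rw [← hPstar, conjTranspose_conjTranspose]
      rw [this]
      calc Pᵀ * W * P * (Pᵀ * (Wᴴ * P)) = Pᵀ * W * (P * Pᵀ) * Wᴴ * P := by
            simp only [Matrix.mul_assoc]
        _ = Pᵀ * (W * Wᴴ) * P := by rw [hPP', Matrix.mul_one, Matrix.mul_assoc Pᵀ]
        _ = 1 := by rw [hWW, Matrix.mul_one, hPP]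
    have h2 := congrFun (congrFun h i) i
    rw [diagonal_conjTranspose, diagonal_mul_diagonal, diagonal_apply_eq, one_apply_eq,
      Pi.star_apply, Complex.star_def, Complex.mul_conj, Complex.normSq_eq_norm_sq] at h2
    have h3 : ‖e2 i‖ ^ 2 = 1 := by exact_mod_cast h2
    exact (pow_eq_one_iff_of_nonneg (norm_nonneg _) two_ne_zero).mp h3
  -- Any square roots will do: a change of sign in `e` is compensated by the corresponding row of
  -- `Q`.
  choose e hen hee using fun i => exists_sq_eq_of_norm_eq_one (he2n i)
  set Q := diagonal (star e) * Pᵀ * V with hQ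
  have hede : diagonal e * diagonal (star e) = 1 := by
    rw [diagonal_mul_diagonal, ← diagonal_one]
    congr 1
    funext i
    exact mul_star_self_of_norm_eq_one (hen i)
  have hede' : diagonal (star e) * diagonal e = 1 := mul_eq_one_comm.mp hede
  have hVPQ : V = P * diagonal e * Q := by
    calc V = P * Pᵀ * V := by rw [hPP', Matrix.one_mul]
      _ = P * (diagonal e * diagonal (star e)) * Pᵀ * V := by rw [hede, Matrix.mul_one]
      _ = P * diagonal e * Q := by simp only [hQ, Matrix.mul_assoc]
  have hQQ : Q * Qᴴ = 1 := by
    have h1 : (diagonal (star e))ᴴ = diagonal e := by rw [diagonal_conjTranspose, star_star]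
    have h2 : (Pᵀ)ᴴ = P := by rw [← hPstar, conjTranspose_conjTranspose]
    rw [hQ, conjTranspose_mul, conjTranspose_mul, h1, h2]
    calc diagonal (star e) * Pᵀ * V * (Vᴴ * (P * diagonal e))
        = diagonal (star e) * Pᵀ * (V * Vᴴ) * P * diagonal e := by simp only [Matrix.mul_assoc]
      _ = diagonal (star e) * (Pᵀ * P) * diagonal e := by
          rw [hV1, Matrix.mul_one]; simp only [Matrix.mul_assoc]
      _ = 1 := by rw [hPP, Matrix.mul_one, hede']
  have hQT : Q * Qᵀ = 1 := by
    rw [hQ, transpose_mul, transpose_mul, diagonal_transpose, transpose_transpose]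
    calc diagonal (star e) * Pᵀ * V * (Vᵀ * (P * diagonal (star e)))
        = diagonal (star e) * (Pᵀ * (V * Vᵀ) * P) * diagonal (star e) := by
          simp only [Matrix.mul_assoc]
      _ = diagonal (star e) * (diagonal e * diagonal e) * diagonal (star e) := by
          rw [← hW, hPWP, diagonal_mul_diagonal e e]
          congr 3
          funext i
          exact (hee i).symm
      _ = (diagonal (star e) * diagonal e) * (diagonal e * diagonal (star e)) := by
          simp only [Matrix.mul_assoc]
      _ = 1 := by rw [hede, hede', Matrix.one_mul]
  -- Both Q* and Qᵀ are inverse to Q, so they agree and Q has real entries.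
  have hQreal : Qᴴ = Qᵀ := by
    have : Qᴴ * Q = 1 := mul_eq_one_comm.mp hQQ
    calc Qᴴ = Qᴴ * (Q * Qᵀ) := by rw [hQT, Matrix.mul_one]
      _ = Qᵀ := by rw [← Matrix.mul_assoc, this, Matrix.one_mul]
  have hQmap : (Q.map Complex.re).map Complex.ofReal = Q := by
    ext i j
    have := congrFun (congrFun hQreal j) i
    simp only [conjTranspose_apply, transpose_apply, Complex.star_def] at this
    simpa using Complex.conj_eq_iff_re.mp this
  refine ⟨O, hO, Q.map Complex.re, ?_, e, hen, ?_⟩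
  · rw [mem_orthogonalGroup_iff]
    apply Matrix.map_injective Complex.ofReal_injective
    refine (map_mul' _ _).trans ?_
    refine Eq.trans ?_ (hQT.trans map_one'.symm)
    rw [hQmap]
    congr 1
    exact congrArg transpose hQmap
  · rw [hQmap, ← hVPQ]

/-- A unitary matrix is a product `O₁ D O₂` with `O₁`, `O₂` special orthogonal and `D` diagonal. -/
theorem exists_specialOrthogonal_mul_diagonal_mul_specialOrthogonal [NeZero n]
    {V : Matrix (Fin n) (Fin n) ℂ} (hV : V ∈ unitaryGroup (Fin n) ℂ) :
    ∃ O₁ ∈ specialOrthogonalGroup (Fin n) ℝ, ∃ O₂ ∈ specialOrthogonalGroup (Fin n) ℝ,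
      ∃ d : Fin n → ℂ, (∀ i, ‖d i‖ = 1) ∧
        V = O₁.map Complex.ofReal * diagonal d * O₂.map Complex.ofReal := by
  obtain ⟨O₁, h₁, O₂, h₂, d, hd, rfl⟩ := exists_orthogonal_mul_diagonal_mul_orthogonal hV
  obtain ⟨s, hs, hs'⟩ := exists_sign_mul_mem_specialOrthogonalGroup h₁
  have h₂' : O₂ᵀ ∈ orthogonalGroup (Fin n) ℝ := by
    rw [mem_orthogonalGroup_iff, transpose_transpose]
    exact (mem_orthogonalGroup_iff' (Fin n) ℝ).mp h₂
  obtain ⟨t, ht, ht'⟩ := exists_sign_mul_mem_specialOrthogonalGroup h₂'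
  have ht'' : diagonal t * O₂ ∈ specialOrthogonalGroup (Fin n) ℝ := by
    rw [mem_specialOrthogonalGroup_iff, mem_orthogonalGroup_iff'] at *
    obtain ⟨h, h'⟩ := ht'
    have htr : (O₂ᵀ * diagonal t)ᵀ = diagonal t * O₂ := by simp
    rw [← htr, transpose_transpose, det_transpose]
    exact ⟨mul_eq_one_comm.mp h, h'⟩
  have norm_sign : ∀ r : ℝ, r * r = 1 → ‖(r : ℂ)‖ = 1 := fun r hr => by
    rcases mul_self_eq_one_iff.mp hr with rfl | rfl <;> simp
  -- The signs put on the columns of O₁ and the rows of O₂ are undone in the diagonal factor,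
  -- because they square to one.
  refine ⟨_, hs', _, ht'', fun i => s i * d i * t i, fun i => ?_, ?_⟩
  · rw [norm_mul, norm_mul, norm_sign _ (hs i), norm_sign _ (ht i), hd i]; norm_num
  · have h1 : (O₁ * diagonal s).map Complex.ofReal =
        O₁.map Complex.ofReal * diagonal (fun i => (s i : ℂ)) := by
      ext i j; simp [mul_diagonal]
    have h2 : (diagonal t * O₂).map Complex.ofReal =
        diagonal (fun i => (t i : ℂ)) * O₂.map Complex.ofReal := by
      ext i j; simp [diagonal_mul]
    have h3 : diagonal d = diagonal (fun i => (s i : ℂ)) *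
        diagonal (fun i => s i * d i * t i) * diagonal (fun i => (t i : ℂ)) := by
      rw [diagonal_mul_diagonal, diagonal_mul_diagonal]
      congr 1
      funext i
      have e1 : (s i : ℂ) * s i = 1 := by exact_mod_cast hs i
      have e2 : (t i : ℂ) * t i = 1 := by exact_mod_cast ht i
      linear_combination (-d i) * e1 * (t i * t i) - d i * e2
    rw [h1, h2, h3]
    simp only [Matrix.mul_assoc]

/-! ### Generation of SO(4) by Givens rotations -/

/-- Rotations in the planes spanned by neighbouring coordinates of `ℝ⁴`. -/
def givens (φ : ℝ) : Fin 3 → Matrix (Fin 4) (Fin 4) ℝ :=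
  ![!![Real.cos φ, Real.sin φ, 0, 0; -Real.sin φ, Real.cos φ, 0, 0; 0, 0, 1, 0; 0, 0, 0, 1],
    !![1, 0, 0, 0; 0, Real.cos φ, Real.sin φ, 0; 0, -Real.sin φ, Real.cos φ, 0; 0, 0, 0, 1],
    !![1, 0, 0, 0; 0, 1, 0, 0; 0, 0, Real.cos φ, Real.sin φ; 0, 0, -Real.sin φ, Real.cos φ]]

theorem givens_neg_mul_givens (φ : ℝ) (k : Fin 3) : givens (-φ) k * givens φ k = 1 := by
  have h := Real.cos_sq_add_sin_sq φ
  ext i j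
  fin_cases k <;> fin_cases i <;> fin_cases j <;>
    simp [givens, mul_apply, Fin.sum_univ_four] <;> linarith

theorem givens_mem (φ : ℝ) (k : Fin 3) : givens φ k ∈ specialOrthogonalGroup (Fin 4) ℝ := by
  have h := Real.cos_sq_add_sin_sq φ
  rw [mem_specialOrthogonalGroup_iff, mem_orthogonalGroup_iff']
  constructor
  · rw [← givens_neg_mul_givens φ k]
    congr 1
    ext i j
    fin_cases k <;> fin_cases i <;> fin_cases j <;> simp [givens]
  · fin_cases k <;> simp [givens, det_succ_row_zero, Fin.sum_univ_succ, Fin.succAbove] <;> linarith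

theorem givens_mul_apply_castSucc (φ : ℝ) (k : Fin 3) (O : Matrix (Fin 4) (Fin 4) ℝ) (j : Fin 4) :
    (givens φ k * O) k.castSucc j = Real.cos φ * O k.castSucc j + Real.sin φ * O k.succ j := by
  fin_cases k <;> simp [givens, mul_apply, Fin.sum_univ_four]

theorem givens_mul_apply_succ (φ : ℝ) (k : Fin 3) (O : Matrix (Fin 4) (Fin 4) ℝ) (j : Fin 4) :
    (givens φ k * O) k.succ j = -Real.sin φ * O k.castSucc j + Real.cos φ * O k.succ j := by
  fin_cases k <;> simp [givens, mul_apply, Fin.sum_univ_four]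

theorem givens_mul_apply_of_ne (φ : ℝ) (k : Fin 3) (O : Matrix (Fin 4) (Fin 4) ℝ) {i : Fin 4}
    (h₁ : i ≠ k.castSucc) (h₂ : i ≠ k.succ) (j : Fin 4) :
    (givens φ k * O) i j = O i j := by
  fin_cases k <;> fin_cases i <;> simp_all [givens, mul_apply, Fin.sum_univ_four]

/-- A Givens rotation annihilates an entry of a matrix and makes the entry above nonnegative. -/
theorem exists_givens_mul_apply_eq_zero (k : Fin 3) (O : Matrix (Fin 4) (Fin 4) ℝ) (j : Fin 4) :
    ∃ φ, (givens φ k * O) k.succ j = 0 ∧ 0 ≤ (givens φ k * O) k.castSucc j := by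
  -- The two entries are read as a plane vector; rotating by its argument turns it onto the
  -- nonnegative first axis.
  set z : ℂ := ⟨O k.castSucc j, O k.succ j⟩ with hz
  have h1 : O k.castSucc j = ‖z‖ * Real.cos z.arg := (Complex.norm_mul_cos_arg z).symm
  have h2 : O k.succ j = ‖z‖ * Real.sin z.arg := (Complex.norm_mul_sin_arg z).symm
  refine ⟨z.arg, ?_, ?_⟩
  · rw [givens_mul_apply_succ, h1, h2]; ring
  · rw [givens_mul_apply_castSucc, h1, h2]
    have : Real.cos z.arg * (‖z‖ * Real.cos z.arg) + Real.sin z.arg * (‖z‖ * Real.sin z.arg)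
        = ‖z‖ * (Real.cos z.arg ^ 2 + Real.sin z.arg ^ 2) := by ring
    rw [this, Real.cos_sq_add_sin_sq, mul_one]
    exact norm_nonneg z

/-- An upper triangular special orthogonal matrix whose first diagonal entries are nonnegative is
the identity. -/
theorem eq_one_of_upperTriangular {O : Matrix (Fin 4) (Fin 4) ℝ}
    (hO : O ∈ specialOrthogonalGroup (Fin 4) ℝ) (h10 : O 1 0 = 0) (h20 : O 2 0 = 0)
    (h30 : O 3 0 = 0) (h21 : O 2 1 = 0) (h31 : O 3 1 = 0) (h32 : O 3 2 = 0) (h00 : 0 ≤ O 0 0)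
    (h11 : 0 ≤ O 1 1) (h22 : 0 ≤ O 2 2) : O = 1 := by
  obtain ⟨hO, hdet⟩ := mem_specialOrthogonalGroup_iff.mp hO
  rw [mem_orthogonalGroup_iff'] at hO
  have key : ∀ i j, O 0 i * O 0 j + O 1 i * O 1 j + O 2 i * O 2 j + O 3 i * O 3 j =
      (1 : Matrix (Fin 4) (Fin 4) ℝ) i j := fun i j => by
    rw [← hO]; simp [mul_apply, Fin.sum_univ_four]
  have sq_one : ∀ r : ℝ, 0 ≤ r → r * r = 1 → r = 1 := fun r h0 h => by
    rcases mul_self_eq_one_iff.mp h with h | h <;> linarith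
  -- Row by row: a column with one remaining entry has that entry equal to 1, and orthogonality to
  -- the other columns then clears the rest of its row.
  have e00 : O 0 0 = 1 := sq_one _ h00 (by simpa [h10, h20, h30] using key 0 0)
  have e01 : O 0 1 = 0 := by simpa [h10, h20, h30, e00] using key 0 1
  have e02 : O 0 2 = 0 := by simpa [h10, h20, h30, e00] using key 0 2
  have e03 : O 0 3 = 0 := by simpa [h10, h20, h30, e00] using key 0 3
  have e11 : O 1 1 = 1 := sq_one _ h11 (by simpa [e01, h21, h31] using key 1 1)
  have e12 : O 1 2 = 0 := by simpa [e01, h21, h31, e11] using key 1 2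
  have e13 : O 1 3 = 0 := by simpa [e01, h21, h31, e11] using key 1 3
  have e22 : O 2 2 = 1 := sq_one _ h22 (by simpa [e02, e12, h32] using key 2 2)
  have e23 : O 2 3 = 0 := by simpa [e02, e12, h32, e22] using key 2 3
  -- No sign is assumed for the last diagonal entry; the determinant fixes it.
  have e33 : O 3 3 = 1 := by
    have hu : O.BlockTriangular id := by
      intro i j hij
      fin_cases i <;> fin_cases j <;> first | assumption | exact absurd hij (by decide)
    rw [det_of_isUpperTriangular hu] at hdet
    simpa [Fin.prod_univ_four, e00, e11, e22] using hdet
  ext i j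
  fin_cases i <;> fin_cases j <;> assumption

/-- Induction principle: the special orthogonal group of `ℝ⁴` is generated by Givens rotations. -/
theorem specialOrthogonalGroup_induction {p : Matrix (Fin 4) (Fin 4) ℝ → Prop} (one : p 1)
    (mul : ∀ φ k O, p O → p (givens φ k * O)) {O : Matrix (Fin 4) (Fin 4) ℝ}
    (hO : O ∈ specialOrthogonalGroup (Fin 4) ℝ) : p O := by
  have back : ∀ φ k O, p (givens φ k * O) → p O := fun φ k O h => by
    have := mul (-φ) k _ h
    rwa [← Matrix.mul_assoc, givens_neg_mul_givens, Matrix.one_mul] at this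
  -- One elimination step. The last two clauses preserve earlier progress: the other rows do not
  -- change, and a column vanishing in both mixed rows continues to vanish there.
  have step : ∀ (k : Fin 3) (j : Fin 4) (O : Matrix (Fin 4) (Fin 4) ℝ),
      O ∈ specialOrthogonalGroup (Fin 4) ℝ →
      ∃ O' ∈ specialOrthogonalGroup (Fin 4) ℝ, (p O' → p O) ∧ O' k.succ j = 0 ∧
        0 ≤ O' k.castSucc j ∧ (∀ i l, i ≠ k.castSucc → i ≠ k.succ → O' i l = O i l) ∧
        ∀ l, O k.castSucc l = 0 → O k.succ l = 0 → O' k.castSucc l = 0 ∧ O' k.succ l = 0 := by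
    intro k j O hO
    obtain ⟨φ, h0, h1⟩ := exists_givens_mul_apply_eq_zero k O j
    refine ⟨_, mul_mem (givens_mem φ k) hO, back φ k O, h0, h1,
      fun i l hi hi' => givens_mul_apply_of_ne φ k O hi hi' l, fun l hl hl' => ?_⟩
    rw [givens_mul_apply_castSucc, givens_mul_apply_succ, hl, hl']
    simp
  -- Columns 0, 1, 2 are cleared below the diagonal from the bottom up, so the last rotation for
  -- each column also makes its diagonal entry nonnegative.
  obtain ⟨A, hA, pA, a30, -, -, -⟩ := step 2 0 O hO
  obtain ⟨B, hB, pB, b20, -, bne, -⟩ := step 1 0 A hA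
  obtain ⟨C, hC, pC, c10, c00, cne, -⟩ := step 0 0 B hB
  have b30 : B 3 0 = 0 := (bne 3 0 (by decide) (by decide)).trans a30
  have c20 : C 2 0 = 0 := (cne 2 0 (by decide) (by decide)).trans b20
  have c30 : C 3 0 = 0 := (cne 3 0 (by decide) (by decide)).trans b30
  obtain ⟨F, hF, pF, f31, -, fne, fz⟩ := step 2 1 C hC
  obtain ⟨f20, f30⟩ := fz 0 c20 c30
  have f10 : F 1 0 = 0 := (fne 1 0 (by decide) (by decide)).trans c10
  have f00 : 0 ≤ F 0 0 := (fne 0 0 (by decide) (by decide)).symm ▸ c00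
  obtain ⟨G, hG, pG, g21, g11, gne, gz⟩ := step 1 1 F hF
  obtain ⟨g10, g20⟩ := gz 0 f10 f20
  have g30 : G 3 0 = 0 := (gne 3 0 (by decide) (by decide)).trans f30
  have g31 : G 3 1 = 0 := (gne 3 1 (by decide) (by decide)).trans f31
  have g00 : 0 ≤ G 0 0 := (gne 0 0 (by decide) (by decide)).symm ▸ f00
  obtain ⟨H, hH, pH, h32, h22, hne, hz⟩ := step 2 2 G hG
  obtain ⟨h20, h30⟩ := hz 0 g20 g30
  obtain ⟨h21, h31⟩ := hz 1 g21 g31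
  have h1 : H = 1 := eq_one_of_upperTriangular hH
    ((hne 1 0 (by decide) (by decide)).trans g10) h20 h30 h21 h31 h32
    ((hne 0 0 (by decide) (by decide)).symm ▸ g00)
    ((hne 1 1 (by decide) (by decide)).symm ▸ g11) h22
  exact pA (pB (pC (pF (pG (pH (h1 ▸ one))))))

/-! ### The magic basis and the decomposition of two-qubit unitaries -/

theorem ofLex_mul (M N : Matrix (Fin 4) (Fin 4) ℂ) : ofLex (M * N) = ofLex M * ofLex N :=
  (submatrix_mul_equiv M N (finProdFinEquiv (m := 2) (n := 2))
    (finProdFinEquiv (m := 2) (n := 2)) (finProdFinEquiv (m := 2) (n := 2))).symm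

theorem ofLex_one : ofLex 1 = 1 := submatrix_one_equiv finProdFinEquiv

theorem ofLex_conjTranspose (M : Matrix (Fin 4) (Fin 4) ℂ) : ofLex Mᴴ = (ofLex M)ᴴ := rfl

theorem ofLex_smul (c : ℂ) (M : Matrix (Fin 4) (Fin 4) ℂ) : ofLex (c • M) = c • ofLex M := rfl

theorem finProdFinEquiv_two_two (a b : Fin 2) :
    (finProdFinEquiv (a, b) : Fin (2 * 2)) = (![![0, 1], ![2, 3]] a b : Fin 4) := by
  fin_cases a <;> fin_cases b <;> rfl

theorem ofLex_apply (M : Matrix (Fin 4) (Fin 4) ℂ) (a b c d : Fin 2) :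
    ofLex M (a, b) (c, d) = M (![![0, 1], ![2, 3]] a b) (![![0, 1], ![2, 3]] c d) := by
  simp only [ofLex, submatrix_apply, finProdFinEquiv_two_two]

theorem sqrt_two_div_two_mul_self :
    ((Real.sqrt 2 / 2 : ℝ) : ℂ) * ((Real.sqrt 2 / 2 : ℝ) : ℂ) = 1 / 2 := by
  have h : Real.sqrt 2 * Real.sqrt 2 = 2 := Real.mul_self_sqrt (by norm_num)
  have : (Real.sqrt 2 / 2) * (Real.sqrt 2 / 2) = 1 / 2 := by nlinarith
  rw [← Complex.ofReal_mul, this]; norm_num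

/-- The two factors √2/2 combine to 1/2, so conjugation by the entangler becomes a computation free
of square roots, ready to be checked entry by entry. -/
theorem E_mul_ofLex_mul_star_E (M : Matrix (Fin 4) (Fin 4) ℂ) :
    E * ofLex M * star E = ofLex ((1 / 2 : ℂ) •
      (!![1, Complex.I, 0, 0; 0, 0, Complex.I, 1; 0, 0, Complex.I, -1; 1, -Complex.I, 0, 0] * M *
        !![1, 0, 0, 1; -Complex.I, 0, 0, Complex.I; 0, -Complex.I, -Complex.I, 0;
          0, 1, -1, 0])) := by
  have h : (!![1, Complex.I, 0, 0; 0, 0, Complex.I, 1; 0, 0, Complex.I, -1;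
      1, -Complex.I, 0, 0])ᴴ = !![1, 0, 0, 1; -Complex.I, 0, 0, Complex.I;
        0, -Complex.I, -Complex.I, 0; 0, 1, -1, 0] := by
    ext i j
    fin_cases i <;> fin_cases j <;> simp
  rw [star_eq_conjTranspose]
  unfold E
  rw [conjTranspose_smul, smul_mul_assoc, smul_mul_assoc, mul_smul_comm, smul_smul,
    ← ofLex_conjTranspose, ← ofLex_mul, ← ofLex_mul, Complex.star_def,
    Complex.conj_ofReal, sqrt_two_div_two_mul_self, ← ofLex_smul, h]

theorem E_mul_star_E : E * star E = 1 := by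
  have h := E_mul_ofLex_mul_star_E 1
  rw [ofLex_one, Matrix.mul_one] at h
  rw [h, ← ofLex_one]
  congr 1
  ext i j
  fin_cases i <;> fin_cases j <;> simp <;> norm_num

theorem star_E_mul_E : star E * E = 1 := mul_eq_one_comm.mp E_mul_star_E

theorem E_mem_unitaryGroup : E ∈ unitaryGroup (Fin 2 × Fin 2) ℂ :=
  mem_unitaryGroup_iff.mpr E_mul_star_E

theorem rotation_mem_unitaryGroup (a : Axis) (φ : ℝ) :
    a.rotation φ ∈ unitaryGroup (Fin 2) ℂ := by
  rw [mem_unitaryGroup_iff, star_eq_conjTranspose]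
  have h : (Real.cos (φ / 2) : ℂ) * Real.cos (φ / 2) + Real.sin (φ / 2) * Real.sin (φ / 2) = 1 := by
    have := Real.cos_sq_add_sin_sq (φ / 2)
    rw [sq, sq] at this
    exact_mod_cast this
  ext i j
  cases a <;> fin_cases i <;> fin_cases j <;>
    simp [Axis.rotation, mul_apply, ← Complex.exp_conj, ← Complex.exp_add, -Complex.ofReal_cos,
      -Complex.ofReal_sin, Complex.conj_ofReal, map_ofNat] <;>
    first | linear_combination h | ring

theorem rotation_z_eq (φ : ℝ) : Axis.z.rotation φ =
    !![(Real.cos (φ / 2) - Real.sin (φ / 2) * Complex.I : ℂ), 0;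
      0, (Real.cos (φ / 2) + Real.sin (φ / 2) * Complex.I : ℂ)] := by
  rw [Axis.rotation, ← mul_neg, mul_comm, mul_comm Complex.I, ← Complex.ofReal_neg,
    Complex.exp_mul_I, Complex.exp_mul_I, ← Complex.ofReal_cos, ← Complex.ofReal_sin,
    ← Complex.ofReal_cos, ← Complex.ofReal_sin, Real.cos_neg, Real.sin_neg]
  simp [sub_eq_add_neg]

/-- Here C and S stand for the cosine and sine of half the angle. Writing C² + S² instead of 1 makes
both sides homogeneous quadratic, so this and the next two identities are polynomial and hold for
arbitrary complex C and S. -/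
theorem E_mul_givens_zero_mul_star_E (C S : ℂ) :
    E * ofLex !![C ^ 2 - S ^ 2, 2 * S * C, 0, 0; -(2 * S * C), C ^ 2 - S ^ 2, 0, 0;
        0, 0, C ^ 2 + S ^ 2, 0; 0, 0, 0, C ^ 2 + S ^ 2] * star E =
      !![C - S * Complex.I, 0; 0, C + S * Complex.I] ⊗ₖ
        !![C - S * Complex.I, 0; 0, C + S * Complex.I] := by
  have hI := Complex.I_sq
  rw [E_mul_ofLex_mul_star_E]
  ext ⟨a, b⟩ ⟨c, d⟩
  rw [ofLex_apply, kroneckerMap_apply]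
  fin_cases a <;> fin_cases b <;> fin_cases c <;> fin_cases d <;> simp <;> ring_nf <;>
    simp only [hI] <;> ring

theorem E_mul_givens_one_mul_star_E (C S : ℂ) :
    E * ofLex !![C ^ 2 + S ^ 2, 0, 0, 0; 0, C ^ 2 - S ^ 2, 2 * S * C, 0;
        0, -(2 * S * C), C ^ 2 - S ^ 2, 0; 0, 0, 0, C ^ 2 + S ^ 2] * star E =
      !![C, S; -S, C] ⊗ₖ !![C, S; -S, C] := by
  have hI := Complex.I_sq
  rw [E_mul_ofLex_mul_star_E]
  ext ⟨a, b⟩ ⟨c, d⟩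
  rw [ofLex_apply, kroneckerMap_apply]
  fin_cases a <;> fin_cases b <;> fin_cases c <;> fin_cases d <;> simp <;> ring_nf <;>
    simp only [hI] <;> ring

theorem E_mul_givens_two_mul_star_E (C S : ℂ) :
    E * ofLex !![C ^ 2 + S ^ 2, 0, 0, 0; 0, C ^ 2 + S ^ 2, 0, 0;
        0, 0, C ^ 2 - S ^ 2, 2 * S * C; 0, 0, -(2 * S * C), C ^ 2 - S ^ 2] * star E =
      !![C + S * Complex.I, 0; 0, C - S * Complex.I] ⊗ₖ
        !![C - S * Complex.I, 0; 0, C + S * Complex.I] := by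
  have hI := Complex.I_sq
  rw [E_mul_ofLex_mul_star_E]
  ext ⟨a, b⟩ ⟨c, d⟩
  rw [ofLex_apply, kroneckerMap_apply]
  fin_cases a <;> fin_cases b <;> fin_cases c <;> fin_cases d <;> simp <;> ring_nf <;>
    simp only [hI] <;> ring

/-- In the magic basis, Givens rotations are local. -/
theorem exists_E_mul_givens_mul_star_E (φ : ℝ) (k : Fin 3) :
    ∃ A ∈ unitaryGroup (Fin 2) ℂ, ∃ B ∈ unitaryGroup (Fin 2) ℂ,
      E * ofLex ((givens φ k).map Complex.ofReal) * star E = A ⊗ₖ B := by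
  have hc : (Real.cos φ : ℂ) = Real.cos (φ / 2) ^ 2 - Real.sin (φ / 2) ^ 2 := by
    have := Real.cos_two_mul' (φ / 2)
    rw [mul_div_cancel₀ φ two_ne_zero] at this
    exact_mod_cast this
  have hs : (Real.sin φ : ℂ) = 2 * Real.sin (φ / 2) * Real.cos (φ / 2) := by
    have := Real.sin_two_mul (φ / 2)
    rw [mul_div_cancel₀ φ two_ne_zero] at this
    exact_mod_cast this
  have h1 : (Real.cos (φ / 2) ^ 2 + Real.sin (φ / 2) ^ 2 : ℂ) = 1 := by
    exact_mod_cast Real.cos_sq_add_sin_sq (φ / 2)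
  have hz := rotation_z_eq (-φ)
  rw [neg_div, Real.cos_neg, Real.sin_neg] at hz
  fin_cases k
  · refine ⟨_, rotation_mem_unitaryGroup .z φ, _, rotation_mem_unitaryGroup .z φ, ?_⟩
    rw [rotation_z_eq, ← E_mul_givens_zero_mul_star_E, h1, ← hc, ← hs]
    congr 3
    ext i j
    fin_cases i <;> fin_cases j <;> simp [givens]
  · refine ⟨_, rotation_mem_unitaryGroup .y φ, _, rotation_mem_unitaryGroup .y φ, ?_⟩
    rw [Axis.rotation, ← E_mul_givens_one_mul_star_E, h1, ← hc, ← hs]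
    congr 3
    ext i j
    fin_cases i <;> fin_cases j <;> simp [givens]
  · refine ⟨_, rotation_mem_unitaryGroup .z (-φ), _, rotation_mem_unitaryGroup .z φ, ?_⟩
    rw [hz, rotation_z_eq]
    have := E_mul_givens_two_mul_star_E (Real.cos (φ / 2)) (Real.sin (φ / 2))
    rw [h1, ← hc, ← hs] at this
    simp only [Complex.ofReal_neg, neg_mul, sub_neg_eq_add, ← sub_eq_add_neg]
    rw [← this]
    congr 3
    ext i j
    fin_cases i <;> fin_cases j <;> simp [givens]

/-- In the magic basis, special orthogonal matrices are local. -/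
theorem exists_E_mul_specialOrthogonal_mul_star_E {O : Matrix (Fin 4) (Fin 4) ℝ}
    (hO : O ∈ specialOrthogonalGroup (Fin 4) ℝ) :
    ∃ A ∈ unitaryGroup (Fin 2) ℂ, ∃ B ∈ unitaryGroup (Fin 2) ℂ,
      E * ofLex (O.map Complex.ofReal) * star E = A ⊗ₖ B := by
  refine specialOrthogonalGroup_induction (p := fun O => ∃ A ∈ unitaryGroup (Fin 2) ℂ,
    ∃ B ∈ unitaryGroup (Fin 2) ℂ, E * ofLex (O.map Complex.ofReal) * star E = A ⊗ₖ B)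
    ?_ (fun φ k O ih => ?_) hO
  · refine ⟨1, one_mem _, 1, one_mem _, ?_⟩
    rw [Matrix.map_one _ Complex.ofReal_zero Complex.ofReal_one, ofLex_one, Matrix.mul_one,
      E_mul_star_E, one_kronecker_one]
  · obtain ⟨A, hA, B, hB, h⟩ := ih
    obtain ⟨A', hA', B', hB', h'⟩ := exists_E_mul_givens_mul_star_E φ k
    refine ⟨A' * A, mul_mem hA' hA, B' * B, mul_mem hB' hB, ?_⟩
    rw [mul_kronecker_mul, ← h, ← h']
    have hm : (givens φ k * O).map Complex.ofReal =
        (givens φ k).map Complex.ofReal * O.map Complex.ofReal :=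
      Matrix.map_mul (f := Complex.ofRealHom)
    rw [hm, ofLex_mul]
    calc _ = E * ofLex ((givens φ k).map Complex.ofReal) * 1 * ofLex (O.map Complex.ofReal)
          * star E := by simp only [Matrix.mul_assoc, Matrix.mul_one]
      _ = _ := by rw [← star_E_mul_E]; simp only [Matrix.mul_assoc]

/-- Every two-qubit unitary is local up to a factor which is diagonal in the magic basis. -/
theorem exists_kronecker_mul_diagonal_mul_kronecker {U : Op}
    (hU : U ∈ unitaryGroup (Fin 2 × Fin 2) ℂ) :
    ∃ U₁ ∈ unitaryGroup (Fin 2) ℂ, ∃ U₂ ∈ unitaryGroup (Fin 2) ℂ,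
      ∃ U₃ ∈ unitaryGroup (Fin 2) ℂ, ∃ U₄ ∈ unitaryGroup (Fin 2) ℂ,
      ∃ d : Fin 2 × Fin 2 → ℂ, (∀ i, ‖d i‖ = 1) ∧
        U = (U₁ ⊗ₖ U₂) * (E * diagonal d * star E) * (U₃ ⊗ₖ U₄) := by
  let e : Fin 2 × Fin 2 ≃ Fin 4 := finProdFinEquiv (m := 2) (n := 2)
  -- V is U written in the magic basis; its orthogonal factors become the local ones.
  set V : Matrix (Fin 4) (Fin 4) ℂ := (star E * U * E).submatrix e.symm e.symm with hVdef
  have hVU : ofLex V = star E * U * E := by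
    ext i j
    exact congrArg₂ (star E * U * E) (e.symm_apply_apply i) (e.symm_apply_apply j)
  have hV : V ∈ unitaryGroup (Fin 4) ℂ := by
    have h : star E * U * E * (star E * U * E)ᴴ = 1 := by
      rw [← star_eq_conjTranspose]
      exact mem_unitaryGroup_iff.mp
        (mul_mem (mul_mem (Unitary.star_mem E_mem_unitaryGroup) hU) E_mem_unitaryGroup)
    rw [mem_unitaryGroup_iff, star_eq_conjTranspose, hVdef, conjTranspose_submatrix,
      submatrix_mul_equiv, h, submatrix_one_equiv]
  obtain ⟨O₁, h₁, O₂, h₂, d, hd, hVd⟩ :=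
    exists_specialOrthogonal_mul_diagonal_mul_specialOrthogonal hV
  obtain ⟨U₁, hU₁, U₂, hU₂, e₁⟩ := exists_E_mul_specialOrthogonal_mul_star_E h₁
  obtain ⟨U₃, hU₃, U₄, hU₄, e₂⟩ := exists_E_mul_specialOrthogonal_mul_star_E h₂
  have hdiag : ofLex (diagonal d) = diagonal (d ∘ e) := submatrix_diagonal_equiv d e
  refine ⟨U₁, hU₁, U₂, hU₂, U₃, hU₃, U₄, hU₄, d ∘ e, fun i => hd _, ?_⟩
  rw [← e₁, ← e₂, ← hdiag]
  calc U = E * star E * U * (E * star E) := by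
        rw [E_mul_star_E, Matrix.one_mul, Matrix.mul_one]
    _ = E * ofLex V * star E := by rw [hVU]; simp only [Matrix.mul_assoc]
    _ = E * (ofLex (O₁.map Complex.ofReal) * 1 * ofLex (diagonal d) * 1 *
          ofLex (O₂.map Complex.ofReal)) * star E := by
        rw [Matrix.mul_one, Matrix.mul_one, hVd, ofLex_mul, ofLex_mul]
    _ = _ := by rw [← star_E_mul_E]; simp only [Matrix.mul_assoc]

/-! ### Circuits, global phases and Euler angles -/

theorem eval_append (C C' : List Gate) : eval (C ++ C') = eval C' * eval C := by
  induction C with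
  | nil => simp [eval]
  | cons g C ih => rw [List.cons_append, eval, eval, ih, Matrix.mul_assoc]

theorem Implements.append {C C' : List Gate} {U V : Op} (h : Implements C U)
    (h' : Implements C' V) : Implements (C ++ C') (V * U) := by
  obtain ⟨c, hc, e⟩ := h
  obtain ⟨c', hc', e'⟩ := h'
  refine ⟨c' * c, by rw [norm_mul, hc, hc', one_mul], ?_⟩
  rw [eval_append, e, e', smul_mul_smul_comm]

theorem instantiate_append {n : ℕ} (T T' : List (Slot n)) (θ : Fin n → Angle) :
    instantiate (T ++ T') θ = instantiate T θ ++ instantiate T' θ := List.map_append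

theorem Line.act_smul (l : Line) (c : ℂ) (A : Matrix (Fin 2) (Fin 2) ℂ) :
    l.act (c • A) = c • l.act A := by
  cases l
  · exact smul_kronecker c A 1
  · exact kronecker_smul c 1 A

theorem Line.act_mul (l : Line) (A B : Matrix (Fin 2) (Fin 2) ℂ) :
    l.act (A * B) = l.act A * l.act B := by
  cases l <;> simp [Line.act, ← mul_kronecker_mul]

theorem act_bot_mul_act_top (A B : Matrix (Fin 2) (Fin 2) ℂ) :
    Line.bot.act B * Line.top.act A = A ⊗ₖ B := by
  simp [Line.act, ← mul_kronecker_mul]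

theorem rotation_z_add (s t : ℝ) :
    Axis.z.rotation (s + t) = Axis.z.rotation s * Axis.z.rotation t := by
  ext i j
  fin_cases i <;> fin_cases j <;> simp [Axis.rotation, ← Complex.exp_add] <;> congr 1 <;> ring

/-- Half angles give the rotations period 4π, so restricting angles to [0, 2π) costs a sign, which
the global phase absorbs. -/
theorem rotation_add_two_pi (a : Axis) (φ : ℝ) :
    a.rotation (φ + 2 * Real.pi) = -a.rotation φ := by
  have h : (φ + 2 * Real.pi) / 2 = φ / 2 + Real.pi := by ring
  have h1 : Complex.exp (Complex.I * Real.pi) = -1 := by rw [mul_comm, Complex.exp_pi_mul_I]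
  have h2 : Complex.exp (-(Complex.I * Real.pi)) = -1 := by rw [Complex.exp_neg, h1]; norm_num
  cases a <;> simp only [Axis.rotation, h, Real.cos_add_pi, Real.sin_add_pi, Complex.ofReal_add,
    mul_add, neg_add, Complex.exp_add, h1, h2] <;> ext i j <;> fin_cases i <;> fin_cases j <;> simp

/-- Every rotation is, up to sign, a rotation with angle in `[0, 2π)`. -/
theorem exists_rotation_eq_smul (a : Axis) (φ : ℝ) :
    ∃ (t : Angle) (ε : ℂ), ‖ε‖ = 1 ∧ a.rotation t = ε • a.rotation φ := by
  have key : ∀ m : ℕ, ∀ ψ, ∃ ε : ℂ, ‖ε‖ = 1 ∧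
      a.rotation (ψ + m * (2 * Real.pi)) = ε • a.rotation ψ := fun m ψ => by
    induction m with
    | zero => exact ⟨1, by simp⟩
    | succ m ih =>
      obtain ⟨ε, hε, h⟩ := ih
      refine ⟨-ε, by rwa [norm_neg], ?_⟩
      rw [Nat.cast_succ, add_mul, one_mul, ← add_assoc, rotation_add_two_pi, h, neg_smul]
  have hp := Real.two_pi_pos
  let k := toIcoDiv hp 0 φ
  have ht : toIcoMod hp 0 φ ∈ Set.Ico 0 (2 * Real.pi) := by
    simpa using toIcoMod_mem_Ico hp 0 φ
  have hk : toIcoMod hp 0 φ + k * (2 * Real.pi) = φ := by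
    have := toIcoMod_add_toIcoDiv_zsmul hp 0 φ
    rwa [zsmul_eq_mul] at this
  refine ⟨⟨_, ht⟩, ?_⟩
  change ∃ ε : ℂ, ‖ε‖ = 1 ∧ a.rotation (toIcoMod hp 0 φ) = ε • a.rotation φ
  generalize toIcoMod hp 0 φ = τ at hk
  rcases Int.eq_nat_or_neg k with ⟨m, hm | hm⟩
  · obtain ⟨ε, hε, h⟩ := key m τ
    have hε0 : ε ≠ 0 := by rintro rfl; simp at hε
    refine ⟨ε⁻¹, by rw [norm_inv, hε, inv_one], ?_⟩
    rw [hm, Int.cast_natCast] at hk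
    rw [← hk, h, smul_smul, inv_mul_cancel₀ hε0, one_smul]
  · obtain ⟨ε, hε, h⟩ := key m φ
    refine ⟨ε, hε, ?_⟩
    have : φ + m * (2 * Real.pi) = τ := by
      rw [hm] at hk; push_cast at hk; linarith
    rw [← this, h]

/-- The matrix `R_z(γ) R_y(β) R_z(α)`. -/
theorem rotation_zyz_eq (α β γ : ℝ) :
    Axis.z.rotation γ * (Axis.y.rotation β * Axis.z.rotation α) =
      !![Complex.exp (-((γ + α) / 2 : ℝ) * Complex.I) * Real.cos (β / 2),
          Complex.exp (-((γ - α) / 2 : ℝ) * Complex.I) * Real.sin (β / 2);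
        -(Complex.exp (((γ - α) / 2 : ℝ) * Complex.I) * Real.sin (β / 2)),
          Complex.exp (((γ + α) / 2 : ℝ) * Complex.I) * Real.cos (β / 2)] := by
  have h1 : Complex.exp (-((γ + α) / 2 : ℝ) * Complex.I) =
      Complex.exp (-(Complex.I * (γ / 2 : ℝ))) * Complex.exp (-(Complex.I * (α / 2 : ℝ))) := by
    rw [← Complex.exp_add]; congr 1; push_cast; ring
  have h2 : Complex.exp (-((γ - α) / 2 : ℝ) * Complex.I) =
      Complex.exp (-(Complex.I * (γ / 2 : ℝ))) * Complex.exp (Complex.I * (α / 2 : ℝ)) := by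
    rw [← Complex.exp_add]; congr 1; push_cast; ring
  have h3 : Complex.exp (((γ - α) / 2 : ℝ) * Complex.I) =
      Complex.exp (Complex.I * (γ / 2 : ℝ)) * Complex.exp (-(Complex.I * (α / 2 : ℝ))) := by
    rw [← Complex.exp_add]; congr 1; push_cast; ring
  have h4 : Complex.exp (((γ + α) / 2 : ℝ) * Complex.I) =
      Complex.exp (Complex.I * (γ / 2 : ℝ)) * Complex.exp (Complex.I * (α / 2 : ℝ)) := by
    rw [← Complex.exp_add]; congr 1; push_cast; ring
  rw [h1, h2, h3, h4, Axis.rotation, Axis.rotation, Axis.rotation]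
  generalize Complex.exp (-(Complex.I * (γ / 2 : ℝ))) = a
  generalize Complex.exp (Complex.I * (γ / 2 : ℝ)) = b
  generalize Complex.exp (-(Complex.I * (α / 2 : ℝ))) = c
  generalize Complex.exp (Complex.I * (α / 2 : ℝ)) = d
  generalize (Real.cos (β / 2) : ℂ) = C
  generalize (Real.sin (β / 2) : ℂ) = S
  ext i j
  fin_cases i <;> fin_cases j <;> simp <;> ring

/-- The entries of a unitary `2 × 2` matrix in terms of its first row and determinant. -/
theorem unitaryGroup_two_entries {U : Matrix (Fin 2) (Fin 2) ℂ}
    (hU : U ∈ unitaryGroup (Fin 2) ℂ) :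
    ‖U 0 0‖ ^ 2 + ‖U 0 1‖ ^ 2 = 1 ∧ ‖U.det‖ = 1 ∧ U 1 0 = -(U.det * star (U 0 1)) ∧
      U 1 1 = U.det * star (U 0 0) := by
  have h : ∀ i j, U i 0 * star (U j 0) + U i 1 * star (U j 1) =
      (1 : Matrix (Fin 2) (Fin 2) ℂ) i j := fun i j => by
    rw [← mem_unitaryGroup_iff.mp hU]
    simp [mul_apply, star_eq_conjTranspose]
  have h00 := h 0 0
  have h10 := h 1 0
  rw [one_apply_eq] at h00
  rw [one_apply_ne (by decide)] at h10
  refine ⟨?_, ?_, ?_, ?_⟩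
  · simp only [Complex.star_def, Complex.mul_conj, Complex.normSq_eq_norm_sq] at h00
    exact_mod_cast h00
  · have := (det_of_mem_unitary hU)
    rw [Unitary.mem_iff] at this
    have h2 := this.2
    rw [Complex.star_def, Complex.mul_conj, Complex.normSq_eq_norm_sq] at h2
    exact (pow_eq_one_iff_of_nonneg (norm_nonneg _) two_ne_zero).mp (by exact_mod_cast h2)
  · rw [det_fin_two]
    linear_combination (-U 1 0) * h00 + U 0 0 * h10
  · rw [det_fin_two]
    linear_combination (-U 1 1) * h00 + U 0 1 * h10

/-- The Euler decomposition of a one-qubit unitary. -/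
theorem exists_rotation_zyz {U : Matrix (Fin 2) (Fin 2) ℂ} (hU : U ∈ unitaryGroup (Fin 2) ℂ) :
    ∃ α β γ : ℝ, ∃ c : ℂ, ‖c‖ = 1 ∧
      Axis.z.rotation γ * (Axis.y.rotation β * Axis.z.rotation α) = c • U := by
  obtain ⟨hpq, hdet, hr, hs⟩ := unitaryGroup_two_entries hU
  set p := U 0 0 with hp
  set q := U 0 1 with hq
  set δ := U.det with hδ
  -- The first row has norm one, so this point lies on the unit circle and its argument serves as
  -- β/2.
  set z : ℂ := ⟨‖p‖, ‖q‖⟩ with hz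
  have hzn : ‖z‖ = 1 := by
    have : ‖z‖ ^ 2 = 1 := by
      rw [← Complex.normSq_eq_norm_sq, Complex.normSq_apply, ← sq, ← sq]; exact hpq
    exact (pow_eq_one_iff_of_nonneg (norm_nonneg _) two_ne_zero).mp this
  have hC : Real.cos z.arg = ‖p‖ := by
    have := Complex.norm_mul_cos_arg z
    rwa [hzn, one_mul] at this
  have hS : Real.sin z.arg = ‖q‖ := by
    have := Complex.norm_mul_sin_arg z
    rwa [hzn, one_mul] at this
  have hpe : ∀ w : ℂ, w = ‖w‖ * Complex.exp (w.arg * Complex.I) :=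
    fun w => (Complex.norm_mul_exp_arg_mul_I w).symm
  have hpe' : ∀ w : ℂ, star w = ‖w‖ * Complex.exp (-w.arg * Complex.I) := fun w => by
    conv_lhs => rw [hpe w]
    rw [Complex.star_def, map_mul, Complex.conj_ofReal, ← Complex.exp_conj, map_mul,
      Complex.conj_ofReal, Complex.conj_I]
    ring_nf
  obtain ⟨ω, hω⟩ : ∃ ω : ℝ, δ = Complex.exp (ω * Complex.I) := by
    have := hpe δ
    rw [hdet, Complex.ofReal_one, one_mul] at this
    exact ⟨_, this⟩
  -- The phase exp(-iω/2) normalizes the determinant to 1. Comparing the phases of the first row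
  -- gives (γ + α)/2 = ω/2 - arg p and (γ - α)/2 = ω/2 - arg q, which determine α and γ.
  refine ⟨q.arg - p.arg, 2 * z.arg, ω - p.arg - q.arg,
    Complex.exp ((-(ω / 2) : ℝ) * Complex.I), Complex.norm_exp_ofReal_mul_I _, ?_⟩
  rw [rotation_zyz_eq, mul_div_cancel_left₀ _ (two_ne_zero (α := ℝ)), hC, hS]
  ext i j
  fin_cases i <;> fin_cases j <;>
    simp only [Fin.zero_eta, Fin.mk_one, Fin.isValue, Matrix.smul_apply, smul_eq_mul,
      of_apply, cons_val', cons_val_zero, cons_val_one, cons_val_fin_one]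
  · rw [← hp]
    conv_rhs => rw [hpe p, mul_left_comm, ← Complex.exp_add]
    rw [mul_comm]
    congr 2
    push_cast
    ring
  · rw [← hq]
    conv_rhs => rw [hpe q, mul_left_comm, ← Complex.exp_add]
    rw [mul_comm]
    congr 2
    push_cast
    ring
  · rw [hr, hpe' q, mul_neg]
    conv_rhs => rw [hω, mul_left_comm _ (‖q‖ : ℂ), mul_left_comm, ← Complex.exp_add,
      ← Complex.exp_add]
    rw [mul_comm]
    congr 3
    push_cast
    ring
  · rw [hs, hpe' p]
    conv_rhs => rw [hω, mul_left_comm _ (‖p‖ : ℂ), mul_left_comm, ← Complex.exp_add,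
      ← Complex.exp_add]
    rw [mul_comm]
    congr 2
    push_cast
    ring

/-- Three rotations suffice for a one-qubit unitary. -/
theorem exists_implements_zyz {U : Matrix (Fin 2) (Fin 2) ℂ} (hU : U ∈ unitaryGroup (Fin 2) ℂ) :
    ∃ α β γ : Angle, ∀ l : Line,
      Implements [.rot .z l α, .rot .y l β, .rot .z l γ] (l.act U) := by
  obtain ⟨α, β, γ, c, hc, h⟩ := exists_rotation_zyz hU
  obtain ⟨α', ε₁, h₁, e₁⟩ := exists_rotation_eq_smul .z α
  obtain ⟨β', ε₂, h₂, e₂⟩ := exists_rotation_eq_smul .y β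
  obtain ⟨γ', ε₃, h₃, e₃⟩ := exists_rotation_eq_smul .z γ
  refine ⟨α', β', γ', fun l => ⟨ε₃ * (ε₂ * ε₁) * c, by simp [h₁, h₂, h₃, hc], ?_⟩⟩
  rw [eval, eval, eval, eval, Matrix.one_mul, Gate.matrix, Gate.matrix, Gate.matrix,
    Matrix.mul_assoc, ← l.act_mul, ← l.act_mul, e₁, e₂, e₃, smul_mul_smul_comm,
    smul_mul_smul_comm, h, smul_smul, Line.act_smul]

/-- Six rotations suffice for a local two-qubit unitary. -/
theorem exists_implements_kronecker {A B : Matrix (Fin 2) (Fin 2) ℂ}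
    (hA : A ∈ unitaryGroup (Fin 2) ℂ) (hB : B ∈ unitaryGroup (Fin 2) ℂ) :
    ∃ t : Fin 6 → Angle,
      Implements ([.rot .z .top (t 0), .rot .y .top (t 1), .rot .z .top (t 2)] ++
        [.rot .z .bot (t 3), .rot .y .bot (t 4), .rot .z .bot (t 5)]) (A ⊗ₖ B) := by
  obtain ⟨α, β, γ, h⟩ := exists_implements_zyz hA
  obtain ⟨α', β', γ', h'⟩ := exists_implements_zyz hB
  refine ⟨![α, β, γ, α', β', γ'], ?_⟩
  rw [← act_bot_mul_act_top]
  exact (h .top).append (h' .bot)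

/-! ### Circuits for the entangler, diagonal unitaries and the core -/

theorem act_top_eq (a b c d : ℂ) : Line.top.act !![a, b; c, d] =
    ofLex !![a, 0, b, 0; 0, a, 0, b; c, 0, d, 0; 0, c, 0, d] := by
  ext ⟨i, j⟩ ⟨k, l⟩
  rw [ofLex_apply, Line.act, kroneckerMap_apply]
  fin_cases i <;> fin_cases j <;> fin_cases k <;> fin_cases l <;> simp

theorem act_bot_eq (a b c d : ℂ) : Line.bot.act !![a, b; c, d] =
    ofLex !![a, b, 0, 0; c, d, 0, 0; 0, 0, a, b; 0, 0, c, d] := by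
  ext ⟨i, j⟩ ⟨k, l⟩
  rw [ofLex_apply, Line.act, kroneckerMap_apply]
  fin_cases i <;> fin_cases j <;> fin_cases k <;> fin_cases l <;> simp

theorem cnotMatrix_bot_mul_self : cnotMatrix .bot * cnotMatrix .bot = 1 := by
  rw [cnotMatrix, ← ofLex_mul, ← ofLex_one]
  congr 1
  ext i j
  fin_cases i <;> fin_cases j <;> simp

theorem rotation_z_pi_mul_rotation_y_half_pi :
    Axis.z.rotation Real.pi * Axis.y.rotation (Real.pi / 2) =
      (-Complex.I * ((Real.sqrt 2 / 2 : ℝ) : ℂ)) • !![1, 1; 1, -1] := by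
  have h : Real.pi / 2 / 2 = Real.pi / 4 := by ring
  rw [rotation_z_eq, Axis.rotation, h, Real.cos_pi_div_two, Real.sin_pi_div_two,
    Real.cos_pi_div_four, Real.sin_pi_div_four]
  generalize ((Real.sqrt 2 / 2 : ℝ) : ℂ) = s
  ext i j
  fin_cases i <;> fin_cases j <;> simp

theorem exists_rotation_z_half_pi : ∃ c : ℂ, ‖c‖ = 1 ∧
    Axis.z.rotation (Real.pi / 2) = c • !![1, 0; 0, Complex.I] := by
  refine ⟨Complex.exp ((-(Real.pi / 4) : ℝ) * Complex.I), Complex.norm_exp_ofReal_mul_I _, ?_⟩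
  have h : Complex.exp ((-(Real.pi / 4) : ℝ) * Complex.I) * Complex.I =
      Complex.exp (Complex.I * (Real.pi / 2 / 2 : ℝ)) := by
    have h4 : Complex.I * (Real.pi / 2 / 2 : ℝ) =
        (-(Real.pi / 4) : ℝ) * Complex.I + Real.pi / 2 * Complex.I := by push_cast; ring
    rw [h4, Complex.exp_add, Complex.exp_pi_div_two_mul_I]
  have h' : Complex.exp ((-(Real.pi / 4) : ℝ) * Complex.I) =
      Complex.exp (-(Complex.I * (Real.pi / 2 / 2 : ℝ))) := by
    congr 1; push_cast; ring
  rw [Axis.rotation, ← h, ← h']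
  ext i j
  fin_cases i <;> fin_cases j <;> simp

theorem exists_rotation_z_three_half_pi : ∃ c : ℂ, ‖c‖ = 1 ∧
    Axis.z.rotation (3 * Real.pi / 2) = c • !![1, 0; 0, -Complex.I] := by
  obtain ⟨c, hc, h⟩ := exists_rotation_z_half_pi
  have hpi : Axis.z.rotation Real.pi = (-Complex.I) • !![1, 0; 0, -1] := by
    rw [rotation_z_eq, Real.cos_pi_div_two, Real.sin_pi_div_two]
    ext i j
    fin_cases i <;> fin_cases j <;> simp
  have hs : 3 * Real.pi / 2 = Real.pi + Real.pi / 2 := by ring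
  refine ⟨-Complex.I * c, by simp [hc], ?_⟩
  rw [hs, rotation_z_add, h, hpi, smul_mul_smul_comm]
  ext i j
  fin_cases i <;> fin_cases j <;> simp

theorem eval_hadamard_bot (θ : Fin n → Angle) :
    eval (instantiate (hadamard .bot) θ) = (-Complex.I * ((Real.sqrt 2 / 2 : ℝ) : ℂ)) •
      ofLex !![1, 1, 0, 0; 1, -1, 0, 0; 0, 0, 1, 1; 0, 0, 1, -1] := by
  rw [← act_bot_eq, ← Line.act_smul, ← rotation_z_pi_mul_rotation_y_half_pi, Line.act_mul]
  simp [instantiate, hadamard, Slot.toGate, eval, Gate.matrix, onePi, halfPi]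

theorem implements_entangler (θ : Fin n → Angle) : Implements (instantiate entangler θ) E := by
  obtain ⟨c, hc, h⟩ := exists_rotation_z_half_pi
  refine ⟨-Complex.I * c, by simp [hc], ?_⟩
  rw [entangler, instantiate_append, instantiate_append, eval_append, eval_append,
    eval_hadamard_bot]
  have e1 : eval (instantiate [.cnot .top, .cnot .bot] θ) =
      cnotMatrix .bot * cnotMatrix .top := by
    simp [instantiate, Slot.toGate, eval, Gate.matrix]
  have e2 : eval (instantiate [.cnot .bot, .const .z .top halfPi, .cnot .bot] θ) =
      cnotMatrix .bot * (c • Line.top.act !![1, 0; 0, Complex.I]) * cnotMatrix .bot := by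
    rw [← Line.act_smul, ← h]
    simp [instantiate, Slot.toGate, eval, Gate.matrix, halfPi]
  rw [e1, e2, act_top_eq, cnotMatrix, cnotMatrix, E]
  -- The √2/2 of the Hadamard gate is the normalization of `E`, so it can stay symbolic; what
  -- remains is a product of matrices with entries 0, ±1 and ±i.
  generalize ((Real.sqrt 2 / 2 : ℝ) : ℂ) = s
  simp only [← ofLex_smul, ← ofLex_mul]
  congr 1
  simp only [Matrix.mul_smul, Matrix.smul_mul, smul_smul]
  rw [show c * (-Complex.I * s) = -Complex.I * c * s by ring]
  congr 1
  ext i j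
  fin_cases i <;> fin_cases j <;> simp

theorem implements_disentangler (θ : Fin n → Angle) :
    Implements (instantiate disentangler θ) (star E) := by
  obtain ⟨c, hc, h⟩ := exists_rotation_z_three_half_pi
  refine ⟨-Complex.I * c, by simp [hc], ?_⟩
  rw [disentangler, instantiate_append, instantiate_append, eval_append, eval_append,
    eval_hadamard_bot]
  have e1 : eval (instantiate [.cnot .bot, .cnot .top] θ) =
      cnotMatrix .top * cnotMatrix .bot := by
    simp [instantiate, Slot.toGate, eval, Gate.matrix]
  have e2 : eval (instantiate [.cnot .bot, .const .z .top threeHalfPi, .cnot .bot] θ) =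
      cnotMatrix .bot * (c • Line.top.act !![1, 0; 0, -Complex.I]) * cnotMatrix .bot := by
    rw [← Line.act_smul, ← h]
    simp [instantiate, Slot.toGate, eval, Gate.matrix, threeHalfPi]
  rw [e1, e2, act_top_eq, cnotMatrix, cnotMatrix, E, star_eq_conjTranspose, conjTranspose_smul,
    ← ofLex_conjTranspose, Complex.star_def, Complex.conj_ofReal]
  generalize ((Real.sqrt 2 / 2 : ℝ) : ℂ) = s
  simp only [← ofLex_smul, ← ofLex_mul]
  congr 1
  simp only [Matrix.mul_smul, Matrix.smul_mul, smul_smul]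
  rw [show -Complex.I * s * c = -Complex.I * c * s by ring]
  congr 1
  ext i j
  fin_cases i <;> fin_cases j <;> simp

/-- Conjugation by the CNOT makes the rotation by γ act through the parity a + b mod 2 of |ab⟩. The
three rotations thus supply phases along the three nontrivial characters of (ℤ/2)². -/
theorem cnot_mul_rotation_mul_cnot_mul_rotation (α β γ : ℝ) :
    cnotMatrix .bot * Line.top.act (Axis.z.rotation γ) * cnotMatrix .bot *
        Line.bot.act (Axis.z.rotation β) * Line.top.act (Axis.z.rotation α) =
      ofLex (diagonal ![Complex.exp ((-(α + β + γ) / 2 : ℝ) * Complex.I),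
        Complex.exp (((-α + β + γ) / 2 : ℝ) * Complex.I),
        Complex.exp (((α - β + γ) / 2 : ℝ) * Complex.I),
        Complex.exp (((α + β - γ) / 2 : ℝ) * Complex.I)]) := by
  rw [Axis.rotation, Axis.rotation, Axis.rotation, act_top_eq, act_top_eq, act_bot_eq, cnotMatrix]
  simp only [← ofLex_mul]
  congr 1
  ext i j
  fin_cases i <;> fin_cases j <;> simp [← Complex.exp_add] <;> congr 1 <;> ring

/-- Five gates suffice for a diagonal unitary. -/
theorem exists_implements_diagonalCircuit {d : Fin 2 × Fin 2 → ℂ} (hd : ∀ i, ‖d i‖ = 1) :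
    ∃ α β γ : Angle, Implements (diagonalCircuit α β γ) (diagonal d) := by
  obtain ⟨a, ha⟩ : ∃ a : Fin 2 × Fin 2 → ℝ, ∀ i, d i = Complex.exp (a i * Complex.I) :=
    ⟨fun i => (d i).arg, fun i => by
      simpa [hd i] using (Complex.norm_mul_exp_arg_mul_I (d i)).symm⟩
  -- The angles are the Fourier coefficients of the exponent `a` on (ℤ/2)², suitably scaled; the
  -- trivial character, the mean of `a`, goes into the global phase.
  obtain ⟨α, ε₁, h₁, e₁⟩ := exists_rotation_eq_smul .z
    ((a (1, 0) + a (1, 1) - a (0, 0) - a (0, 1)) / 2)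
  obtain ⟨β, ε₂, h₂, e₂⟩ := exists_rotation_eq_smul .z
    ((a (0, 1) + a (1, 1) - a (0, 0) - a (1, 0)) / 2)
  obtain ⟨γ, ε₃, h₃, e₃⟩ := exists_rotation_eq_smul .z
    ((a (0, 1) + a (1, 0) - a (0, 0) - a (1, 1)) / 2)
  refine ⟨α, β, γ, ε₁ * (ε₂ * (ε₃ * Complex.exp
    ((-(a (0, 0) + a (0, 1) + a (1, 0) + a (1, 1)) / 4 : ℝ) * Complex.I))), ?_, ?_⟩
  · rw [norm_mul, norm_mul, norm_mul, h₁, h₂, h₃, Complex.norm_exp_ofReal_mul_I]; norm_num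
  · simp only [diagonalCircuit, eval, Gate.matrix, Matrix.one_mul, e₁, e₂, e₃, Line.act_smul,
      Matrix.mul_smul, Matrix.smul_mul, cnot_mul_rotation_mul_cnot_mul_rotation, mul_smul]
    congr 3
    ext ⟨i, j⟩ ⟨k, l⟩
    rw [ofLex_apply, Matrix.smul_apply, smul_eq_mul]
    fin_cases i <;> fin_cases j <;> fin_cases k <;> fin_cases l <;>
      simp [ha, ← Complex.exp_add] <;> congr 1 <;> ring

/-- The core circuit merges the circuits for the disentangler, a diagonal unitary and the
entangler. -/
theorem implements_core {i j k : Fin n} {θ : Fin n → Angle} {γ : Angle} {D : Op} {ε : ℂ}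
    (hε : ‖ε‖ = 1) (hk : Axis.z.rotation (θ k) = ε • Axis.z.rotation (Real.pi / 2 + γ))
    (hD : Implements (diagonalCircuit (θ i) (θ j) γ) D) :
    Implements (instantiate (core i j k) θ) (E * D * star E) := by
  obtain ⟨c, hc, e⟩ := (((implements_disentangler θ).append hD).append (implements_entangler θ))
  refine ⟨ε * c, by rw [norm_mul, hε, hc, one_mul], ?_⟩
  rw [Matrix.mul_assoc, mul_smul, ← e, eval_append, eval_append, core, entangler]
  simp only [instantiate_append, eval_append]
  generalize eval (instantiate disentangler θ) = M
  generalize eval (instantiate (hadamard .bot) θ) = H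
  generalize eval (instantiate [.cnot .top, .cnot .bot] θ) = N
  simp only [instantiate, diagonalCircuit, List.map, Slot.toGate, eval, Gate.matrix, Matrix.one_mul,
    hk, halfPi, rotation_z_add, Line.act_mul, Line.act_smul, Matrix.mul_smul, Matrix.smul_mul]
  congr 1
  simp only [Matrix.mul_assoc]
  -- The last CNOT of the diagonal circuit meets the first CNOT of the entangler, and they cancel.
  rw [← Matrix.mul_assoc (cnotMatrix .bot) (cnotMatrix .bot), cnotMatrix_bot_mul_self,
    Matrix.one_mul]

end

end TwoQubit

/-! ### Assembly of the 28-gate circuit -/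

theorem mainTheorem7 :
    -- the gate counts of the parametrized circuit, which does not depend on the unitary
    (TwoQubit.circuit28.length = 28 ∧
      TwoQubit.circuit28.countP TwoQubit.Slot.isVariable = 15 ∧
      TwoQubit.circuit28.countP TwoQubit.Slot.isConstant = 5 ∧
      TwoQubit.circuit28.countP TwoQubit.Slot.isCnot = 8 ∧
      ∀ j : Fin 15, TwoQubit.circuit28.countP (TwoQubit.Slot.usesParam j) = 1) ∧
    -- the circuits for the entangler and the disentangler
    (∀ θ : Fin 15 → TwoQubit.Angle,
      TwoQubit.Implements (TwoQubit.instantiate TwoQubit.entangler θ) TwoQubit.E ∧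
      TwoQubit.Implements (TwoQubit.instantiate TwoQubit.disentangler θ)
        (star TwoQubit.E)) ∧
    -- every two-qubit unitary is computed by the circuit, part by part
    (∀ U ∈ Matrix.unitaryGroup (Fin 2 × Fin 2) ℂ,
      ∃ U₁ ∈ Matrix.unitaryGroup (Fin 2) ℂ, ∃ U₂ ∈ Matrix.unitaryGroup (Fin 2) ℂ,
      ∃ U₃ ∈ Matrix.unitaryGroup (Fin 2) ℂ, ∃ U₄ ∈ Matrix.unitaryGroup (Fin 2) ℂ,
      ∃ d : Fin 2 × Fin 2 → ℂ, (∀ i, ‖d i‖ = 1) ∧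
        U = (U₁ ⊗ₖ U₂) * (TwoQubit.E * Matrix.diagonal d * star TwoQubit.E) * (U₃ ⊗ₖ U₄) ∧
        ∃ θ : Fin 15 → TwoQubit.Angle,
          TwoQubit.Implements (TwoQubit.instantiate TwoQubit.firstLayer θ) (U₃ ⊗ₖ U₄) ∧
          (∃ γ : TwoQubit.Angle,
            TwoQubit.Implements (TwoQubit.diagonalCircuit (θ 6) (θ 7) γ)
              (Matrix.diagonal d)) ∧
          TwoQubit.Implements (TwoQubit.instantiate (TwoQubit.core 6 7 8) θ)
            (TwoQubit.E * Matrix.diagonal d * star TwoQubit.E) ∧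
          TwoQubit.Implements (TwoQubit.instantiate TwoQubit.lastLayer θ) (U₁ ⊗ₖ U₂) ∧
          TwoQubit.Implements (TwoQubit.instantiate TwoQubit.circuit28 θ) U) := by
  refine ⟨⟨rfl, rfl, rfl, rfl, fun j => by fin_cases j <;> rfl⟩,
    fun θ => ⟨TwoQubit.implements_entangler θ, TwoQubit.implements_disentangler θ⟩,
    fun U hU => ?_⟩
  obtain ⟨U₁, h₁, U₂, h₂, U₃, h₃, U₄, h₄, d, hd, hUd⟩ :=
    TwoQubit.exists_kronecker_mul_diagonal_mul_kronecker hU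
  obtain ⟨s, hs⟩ := TwoQubit.exists_implements_kronecker h₃ h₄
  obtain ⟨t, ht⟩ := TwoQubit.exists_implements_kronecker h₁ h₂
  obtain ⟨α, β, γ, hD⟩ := TwoQubit.exists_implements_diagonalCircuit hd
  -- The merged angle π/2 + γ may leave [0, 2π); δ represents it up to the phase ε.
  obtain ⟨δ, ε, hε, hδ⟩ := TwoQubit.exists_rotation_eq_smul .z (Real.pi / 2 + γ)
  let θ : Fin 15 → TwoQubit.Angle := ![s 0, s 1, s 2, s 3, s 4, s 5, α, β, δ,
    t 0, t 1, t 2, t 3, t 4, t 5]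
  have hfirst : TwoQubit.Implements (TwoQubit.instantiate TwoQubit.firstLayer θ) (U₃ ⊗ₖ U₄) := hs
  have hlast : TwoQubit.Implements (TwoQubit.instantiate TwoQubit.lastLayer θ) (U₁ ⊗ₖ U₂) := ht
  have hcore : TwoQubit.Implements (TwoQubit.instantiate (TwoQubit.core 6 7 8) θ)
      (TwoQubit.E * Matrix.diagonal d * star TwoQubit.E) :=
    TwoQubit.implements_core hε hδ hD
  refine ⟨U₁, h₁, U₂, h₂, U₃, h₃, U₄, h₄, d, hd, hUd, θ, hfirst, ⟨γ, hD⟩, hcore, hlast, ?_⟩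
  rw [hUd, TwoQubit.circuit28, TwoQubit.instantiate_append, TwoQubit.instantiate_append,
    Matrix.mul_assoc]
  exact (hfirst.append hcore).append hlast
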